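/- For a finite graph $G$ and a positive integer $r$, let $\mathrm{tc}_r(G)$ be the minimum number $k$ such that in every (not necessarily proper) colouring of the edges of $G$ with $r$ colours there are $k$ monochromatic trees $T_1,\dots,T_k\subseteq G$, not necessarily disjoint, with $V(G)=V(T_1)\cup\dots\cup V(T_k)$; a single vertex counts as a monochromatic tree. Let $G(n,p)$ be the random graph on $n$ vertices in which each pair of vertices is an edge independently with probability $p$. Theorem. Let $p=p(n)\in[0,1]$ satisfy $p\gg\left(\frac{\log n}{n}\right)^{1/6}$, that is, $p(n)\big/\left(\frac{\log n}{n}\right)^{1/6}\to\infty$ as $n\to\infty$. Then with high probability $\mathrm{tc}_3\big(G(n,p)\big)\le 3$, that is, $$\lim_{n\to\infty}\Pr\big[\mathrm{tc}_3(G(n,p(n)))\le 3\big]=1 .$$ -/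

import Mathlib

open Filter Topology Asymptotics

namespace SimpleGraph

/-- A subgraph `T` of `G` is a monochromatic tree under the edge-colouring `φ` if it is a tree all
of whose edges have one and the same colour. A single vertex is a monochromatic tree. -/
def IsMonochromaticTree {V K : Type*} {G : SimpleGraph V} (φ : G.EdgeLabeling K)
    (T : G.Subgraph) : Prop :=
  T.coe.IsTree ∧ ∃ c : K, ∀ (e : Sym2 V) (he : e ∈ T.edgeSet), φ ⟨e, T.edgeSet_subset he⟩ = c

/-- `G.TreeCoverable r k`: for every (not necessarily proper) edge-colouring of `G` with `r`
colours there are `k` monochromatic trees, not necessarily disjoint or distinct, whose vertex sets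
together cover the vertex set of `G`. -/
def TreeCoverable {V : Type*} (G : SimpleGraph V) (r k : ℕ) : Prop :=
  ∀ φ : G.EdgeLabeling (Fin r), ∃ T : Fin k → G.Subgraph,
    (∀ i, IsMonochromaticTree φ (T i)) ∧ ⋃ i, (T i).verts = Set.univ

/-- The tree cover number `tc_r(G)`: the minimum `k` such that in every `r`-edge-colouring of `G`
there are `k` monochromatic trees covering all vertices. It takes values in `ℕ∞`, so that it is
`⊤` when there is no such `k`. -/
noncomputable def treeCoverNumber {V : Type*} (r : ℕ) (G : SimpleGraph V) : ℕ∞ :=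
  ⨅ (k : ℕ) (_ : G.TreeCoverable r k), (k : ℕ∞)

end SimpleGraph

/-! If any six vertices have a common neighbour, three trees suffice in every 3-colouring. Let the
monochromatic components be the vertices of a 3-partite hypergraph in which each vertex of the graph
is the edge formed by its three components. The components of a common neighbour are a transversal
meeting six given edges, and a vertex cover of size three yields three spanning trees of components
that cover the graph. So the core is `not_noThreeCover_of_sixMeet`.

Suppose no three vertices cover. Kőnig's theorem gives four edges `u₁, …, u₄` disjoint in the last
two parts; the six-edge condition forces them to form two pairs in the first part
(`exists_pairedFour`). An edge outside both pairs' first-part vertices must join the `b` of some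
`uᵢ` to the `c` of some `uⱼ` from the other pair (`cell_of_pairedFour`); such a cell `ij` is, by
symmetry, `13`, and `false_of_cell_13` excludes it.

In the random graph a union bound over 6-tuples shows that with high probability every six vertices
have a common neighbour. -/

/-- **Kőnig's theorem** for the bipartite multigraph with edge set `W` whose edge `v` joins `b v` to
`c v`: if no fewer than `k` vertices cover all edges, then there is a matching of size `k`. -/
theorem exists_matching_of_forall_not_cover {V β γ : Type*} [Finite V] (b : V → β) (c : V → γ)
    (W : Set V) (k : ℕ)
    (h : ∀ (Q : Finset β) (R : Finset γ), Q.card + R.card < k → ∃ v ∈ W, b v ∉ Q ∧ c v ∉ R) :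
    ∃ f : Fin k → V, (∀ i, f i ∈ W) ∧ (b ∘ f).Injective ∧ (c ∘ f).Injective := by
  classical
  have := Fintype.ofFinite V
  let W' : Finset V := Finset.univ.filter (· ∈ W)
  let L : Finset β := W'.image b
  have hL : k ≤ L.card := by
    by_contra hlt
    obtain ⟨v, hv, hvL, -⟩ := h L ∅ (by simpa using hlt)
    exact hvL (Finset.mem_image_of_mem b (by simpa [W'] using hv))
  let N : L → Finset γ := fun x => (W'.filter (b · = x)).image c
  -- Hall's theorem with deficiency: `L.card - k` dummy partners are available to everyone, so at
  -- least `k` members of `L` get a genuine partner.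
  let t : L → Finset (γ ⊕ Fin (L.card - k)) := fun x => (N x).disjSum Finset.univ
  have hall : ∀ S : Finset L, S.card ≤ (S.biUnion t).card := by
    intro S
    rcases S.eq_empty_or_nonempty with rfl | hS
    · simp
    have hu : (S.biUnion N).disjSum Finset.univ ⊆ S.biUnion t := by
      intro x hx
      rcases x with x | x
      · simpa [t] using hx
      · obtain ⟨s, hs⟩ := hS
        exact Finset.mem_biUnion.2 ⟨s, hs, by simp [t]⟩
    have hc := Finset.card_le_card hu
    rw [Finset.card_disjSum, Finset.card_univ, Fintype.card_fin] at hc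
    have hSL : (S.map (Function.Embedding.subtype _)).card = S.card := Finset.card_map _
    have hsub : S.map (Function.Embedding.subtype _) ⊆ L := by
      intro x hx
      obtain ⟨y, -, rfl⟩ := Finset.mem_map.1 hx
      exact y.2
    -- The part of `L` outside `S` together with the neighbourhood of `S` covers all edges.
    have hcov : k ≤ (L \ S.map (Function.Embedding.subtype _)).card + (S.biUnion N).card := by
      by_contra hlt
      obtain ⟨v, hv, hv1, hv2⟩ := h _ _ (not_le.1 hlt)
      have hvW : v ∈ W' := by simpa [W'] using hv
      have hbL : b v ∈ L := Finset.mem_image_of_mem b hvW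
      have hbS : (⟨b v, hbL⟩ : L) ∈ S := by
        by_contra hn
        exact hv1 (Finset.mem_sdiff.2 ⟨hbL, fun hm => by simp_all⟩)
      exact hv2 (Finset.mem_biUnion.2 ⟨_, hbS, Finset.mem_image_of_mem c (by simp [hvW])⟩)
    rw [Finset.card_sdiff_of_subset hsub] at hcov
    have := Finset.card_le_card hsub
    omega
  obtain ⟨g, hg, hgt⟩ := (Finset.all_card_le_biUnion_card_iff_exists_injective t).1 hall
  have hk : k ≤ (Finset.univ.filter fun x => (g x).isLeft).card := by
    have h1 := Finset.card_filter_add_card_filter_not (s := (Finset.univ : Finset L))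
      (fun x => (g x).isLeft)
    have h2 : (Finset.univ.filter fun x => ¬ (g x).isLeft).card ≤ L.card - k := by
      have : (Finset.univ.filter fun x => ¬ (g x).isLeft).image g ⊆
          (Finset.univ : Finset (Fin (L.card - k))).map Function.Embedding.inr := by
        intro y hy
        obtain ⟨x, hx, rfl⟩ := Finset.mem_image.1 hy
        rcases hgx : g x with z | z <;> simp_all
      have := Finset.card_le_card this
      rwa [Finset.card_image_of_injective _ hg, Finset.card_map, Finset.card_univ,
        Fintype.card_fin] at this
    simp only [Finset.card_univ, Fintype.card_coe] at h1
    omega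
  obtain ⟨K, hKs, hK⟩ := Finset.exists_subset_card_eq hk
  have hv : ∀ x ∈ K, ∃ v ∈ W, b v = x ∧ g x = Sum.inl (c v) := by
    intro x hx
    have hl := (Finset.mem_filter.1 (hKs hx)).2
    have ht := hgt x
    rcases hgx : g x with z | z
    · rw [hgx] at ht
      simp only [t, N, Finset.inl_mem_disjSum, Finset.mem_image, Finset.mem_filter, W',
        Finset.mem_univ, true_and] at ht
      obtain ⟨v, ⟨hv, hb⟩, rfl⟩ := ht
      exact ⟨v, hv, hb, rfl⟩
    · simp [hgx] at hl
  choose v hvW hvb hvc using hv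
  let e := (K.equivFinOfCardEq hK).symm
  refine ⟨fun i => v _ (e i).2, fun i => hvW _ (e i).2, fun i j hij => ?_, fun i j hij => ?_⟩
  · have : ((e i : L) : β) = (e j : L) := by
      rw [← hvb _ (e i).2, ← hvb _ (e j).2]; exact hij
    exact e.injective (Subtype.ext (Subtype.ext this))
  · have : g (e i) = g (e j) := by
      rw [hvc _ (e i).2, hvc _ (e j).2]; exact congrArg Sum.inl hij
    exact e.injective (Subtype.ext (hg this))

/-! ### Vertex covers of 3-partite hypergraphs -/

section Hypergraph

/-! A type `V` with three maps `a`, `b`, `c` is a 3-partite 3-uniform hypergraph: the edge `v` is the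
triple `(a v, b v, c v)`. -/

variable {V α β γ : Type*} {a : V → α} {b : V → β} {c : V → γ}

/-- Any six edges are met by a common transversal `(x, y, z)`. -/
def SixMeet (a : V → α) (b : V → β) (c : V → γ) : Prop :=
  ∀ v₁ v₂ v₃ v₄ v₅ v₆ : V, ∃ x y z, (a v₁ = x ∨ b v₁ = y ∨ c v₁ = z) ∧
    (a v₂ = x ∨ b v₂ = y ∨ c v₂ = z) ∧ (a v₃ = x ∨ b v₃ = y ∨ c v₃ = z) ∧
    (a v₄ = x ∨ b v₄ = y ∨ c v₄ = z) ∧ (a v₅ = x ∨ b v₅ = y ∨ c v₅ = z) ∧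
    (a v₆ = x ∨ b v₆ = y ∨ c v₆ = z)

/-- No three vertices cover all edges. -/
def NoThreeCover (a : V → α) (b : V → β) (c : V → γ) : Prop :=
  ∀ (P : Finset α) (Q : Finset β) (R : Finset γ), P.card + Q.card + R.card ≤ 3 →
    ∃ v, a v ∉ P ∧ b v ∉ Q ∧ c v ∉ R

/-- The edges `u`, `v` are disjoint outside the first part. -/
def Apart (b : V → β) (c : V → γ) (u v : V) : Prop := b u ≠ b v ∧ c u ≠ c v

/-- Four edges that are pairwise disjoint outside the first part. -/
def FourApart (b : V → β) (c : V → γ) (u₁ u₂ u₃ u₄ : V) : Prop :=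
  Apart b c u₁ u₂ ∧ Apart b c u₁ u₃ ∧ Apart b c u₁ u₄ ∧ Apart b c u₂ u₃ ∧ Apart b c u₂ u₄ ∧
    Apart b c u₃ u₄

/-- Four edges, pairwise disjoint outside the first part, that form two pairs in the first part. -/
def PairedFour (a : V → α) (b : V → β) (c : V → γ) (u₁ u₂ u₃ u₄ : V) : Prop :=
  FourApart b c u₁ u₂ u₃ u₄ ∧ a u₁ = a u₂ ∧ a u₃ = a u₄ ∧ a u₁ ≠ a u₃

namespace PairedFour

variable {u₁ u₂ u₃ u₄ : V}

lemma swap_left (h : PairedFour a b c u₁ u₂ u₃ u₄) : PairedFour a b c u₂ u₁ u₃ u₄ := by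
  simp only [PairedFour, FourApart, Apart] at *
  grind

lemma swap_right (h : PairedFour a b c u₁ u₂ u₃ u₄) : PairedFour a b c u₁ u₂ u₄ u₃ := by
  simp only [PairedFour, FourApart, Apart] at *
  grind

lemma swap_pairs (h : PairedFour a b c u₁ u₂ u₃ u₄) : PairedFour a b c u₃ u₄ u₁ u₂ := by
  simp only [PairedFour, FourApart, Apart] at *
  grind

end PairedFour

namespace NoThreeCover

lemma exists_avoid_abc (h : NoThreeCover a b c) (x : α) (y : β) (z : γ) :
    ∃ v, a v ≠ x ∧ b v ≠ y ∧ c v ≠ z := by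
  simpa using h {x} {y} {z} (by simp)

lemma exists_avoid_aab (h : NoThreeCover a b c) (x x' : α) (y : β) :
    ∃ v, a v ≠ x ∧ a v ≠ x' ∧ b v ≠ y := by
  classical
  simpa [and_assoc] using h {x, x'} {y} ∅ (by
    have := Finset.card_le_two (a := x) (b := x'); simp; omega)

lemma exists_avoid_aac (h : NoThreeCover a b c) (x x' : α) (z : γ) :
    ∃ v, a v ≠ x ∧ a v ≠ x' ∧ c v ≠ z := by
  classical
  simpa [and_assoc] using h {x, x'} ∅ {z} (by
    have := Finset.card_le_two (a := x) (b := x'); simp; omega)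

lemma exists_avoid_aaa (h : NoThreeCover a b c) (x x' x'' : α) :
    ∃ v, a v ≠ x ∧ a v ≠ x' ∧ a v ≠ x'' := by
  classical
  simpa [and_assoc] using h {x, x', x''} ∅ ∅ (by
    have := Finset.card_le_three (a := x) (b := x') (c := x''); simpa)

lemma exists_fourApart [Finite V] (h : NoThreeCover a b c) :
    ∃ u₁ u₂ u₃ u₄, FourApart b c u₁ u₂ u₃ u₄ := by
  obtain ⟨f, -, hb, hc⟩ := exists_matching_of_forall_not_cover b c Set.univ 4 fun Q R hQR => by
    simpa using h ∅ Q R (by simp; omega)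
  have hf : ∀ i j, i ≠ j → Apart b c (f i) (f j) := fun i j hij => ⟨hb.ne hij, hc.ne hij⟩
  exact ⟨f 0, f 1, f 2, f 3, hf _ _ (by decide), hf _ _ (by decide), hf _ _ (by decide),
    hf _ _ (by decide), hf _ _ (by decide), hf _ _ (by decide)⟩

lemma exists_threeApart [Finite V] (h : NoThreeCover a b c) (x : α) :
    ∃ g₁ g₂ g₃, a g₁ ≠ x ∧ a g₂ ≠ x ∧ a g₃ ≠ x ∧ Apart b c g₁ g₂ ∧ Apart b c g₁ g₃ ∧
      Apart b c g₂ g₃ := by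
  obtain ⟨f, ha, hb, hc⟩ := exists_matching_of_forall_not_cover b c {v | a v ≠ x} 3
    fun Q R hQR => by simpa using h {x} Q R (by simp; omega)
  have hf : ∀ i j, i ≠ j → Apart b c (f i) (f j) := fun i j hij => ⟨hb.ne hij, hc.ne hij⟩
  exact ⟨f 0, f 1, f 2, ha 0, ha 1, ha 2, hf _ _ (by decide), hf _ _ (by decide),
    hf _ _ (by decide)⟩

end NoThreeCover

/-- Three edges avoiding `a v₁` are also pairwise apart. The first coordinate of a transversal
misses one of the two triples entirely, and two further vertices cannot meet three edges that are
apart. -/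
lemma not_threeApart_of_eq [Finite V] (h6 : SixMeet a b c) (hcov : NoThreeCover a b c)
    {v₁ v₂ v₃ : V} (h₂ : a v₂ = a v₁) (h₃ : a v₃ = a v₁)
    (h₁₂ : Apart b c v₁ v₂) (h₁₃ : Apart b c v₁ v₃) (h₂₃ : Apart b c v₂ v₃) : False := by
  obtain ⟨g₁, g₂, g₃, hg₁, hg₂, hg₃, hg₁₂, hg₁₃, hg₂₃⟩ := hcov.exists_threeApart (a v₁)
  obtain ⟨x, y, z, h⟩ := h6 v₁ v₂ v₃ g₁ g₂ g₃
  simp only [Apart] at *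
  grind

/-- If `a v₃ ≠ a v₄`, a transversal of the four edges must be `a v₁` with `(b v₃, c v₄)` or `(b v₄,
c v₃)`; `g` and `g'` are chosen to miss one each. -/
lemma eq_of_fourApart_of_eq [Finite V] (h6 : SixMeet a b c) (hcov : NoThreeCover a b c)
    {v₁ v₂ v₃ v₄ : V} (h : FourApart b c v₁ v₂ v₃ v₄) (h₂ : a v₁ = a v₂) :
    a v₃ = a v₄ ∧ a v₃ ≠ a v₁ := by
  have h₃ : a v₃ ≠ a v₁ := fun h₃ =>
    not_threeApart_of_eq h6 hcov h₂.symm h₃ h.1 h.2.1 h.2.2.2.1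
  have h₄ : a v₄ ≠ a v₁ := fun h₄ =>
    not_threeApart_of_eq h6 hcov h₂.symm h₄ h.1 h.2.2.1 h.2.2.2.2.1
  refine ⟨?_, h₃⟩
  by_contra h₃₄
  obtain ⟨g, hg⟩ := hcov.exists_avoid_abc (a v₁) (b v₃) (c v₄)
  obtain ⟨g', hg'⟩ := hcov.exists_avoid_abc (a v₁) (b v₄) (c v₃)
  obtain ⟨x, y, z, h⟩ := h6 v₁ v₂ v₃ v₄ g g'
  simp only [FourApart, Apart] at *
  grind

lemma exists_pairedFour [Finite V] (h6 : SixMeet a b c) (hcov : NoThreeCover a b c) :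
    ∃ u₁ u₂ u₃ u₄, PairedFour a b c u₁ u₂ u₃ u₄ := by
  obtain ⟨u₁, u₂, u₃, u₄, h⟩ := hcov.exists_fourApart
  have key : ∀ v₁ v₂ v₃ v₄, FourApart b c v₁ v₂ v₃ v₄ → a v₁ = a v₂ →
      ∃ u₁ u₂ u₃ u₄, PairedFour a b c u₁ u₂ u₃ u₄ :=
    fun v₁ v₂ v₃ v₄ h h₂ => ⟨v₁, v₂, v₃, v₄, h, h₂, (eq_of_fourApart_of_eq h6 hcov h h₂).1,
      (eq_of_fourApart_of_eq h6 hcov h h₂).2.symm⟩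
  -- Outside the first part a transversal meets at most two of the four, so its first coordinate is
  -- shared by two.
  obtain ⟨x, y, z, hm⟩ := h6 u₁ u₂ u₃ u₄ u₁ u₁
  have hex : a u₁ = a u₂ ∨ a u₁ = a u₃ ∨ a u₁ = a u₄ ∨ a u₂ = a u₃ ∨ a u₂ = a u₄ ∨ a u₃ = a u₄ := by
    simp only [FourApart, Apart] at h
    grind
  simp only [FourApart, Apart] at h key
  rcases hex with e | e | e | e | e | e
  · exact key u₁ u₂ u₃ u₄ (by grind) e
  · exact key u₁ u₃ u₂ u₄ (by grind) e
  · exact key u₁ u₄ u₂ u₃ (by grind) e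
  · exact key u₂ u₃ u₁ u₄ (by grind) e
  · exact key u₂ u₄ u₁ u₃ (by grind) e
  · exact key u₃ u₄ u₁ u₂ (by grind) e

section PairedFour

variable {u₁ u₂ u₃ u₄ g g' : V}

/-- A transversal of the four `uᵢ` takes one pair by its first coordinate and the other by `b` and
`c`: it is `a u₁` with cell `34` or `43`, or `a u₃` with cell `12` or `21`. Only `a u₃` with `12`
meets `g`, and `h` misses it. -/
lemma not_cell_12 (h6 : SixMeet a b c) (hcov : NoThreeCover a b c)
    (hu : PairedFour a b c u₁ u₂ u₃ u₄) (h₁ : a g ≠ a u₁) (h₃ : a g ≠ a u₃) :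
    b g ≠ b u₁ ∨ c g ≠ c u₂ := by
  obtain ⟨h, hh⟩ := hcov.exists_avoid_abc (a u₃) (b u₁) (c u₂)
  obtain ⟨x, y, z, hm⟩ := h6 u₁ u₂ u₃ u₄ g h
  simp only [PairedFour, FourApart, Apart] at *
  grind

lemma meet_of_pairedFour [Finite V] (h6 : SixMeet a b c) (hcov : NoThreeCover a b c)
    (hu : PairedFour a b c u₁ u₂ u₃ u₄) (h₁ : a g ≠ a u₁) :
    b g = b u₂ ∨ c g = c u₂ ∨ b g = b u₃ ∨ c g = c u₃ ∨ b g = b u₄ ∨ c g = c u₄ := by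
  by_contra! hg
  have := eq_of_fourApart_of_eq (v₁ := u₃) (v₂ := u₄) (v₃ := u₂) (v₄ := g) h6 hcov (by
    simp only [PairedFour, FourApart, Apart] at *
    grind) hu.2.2.1
  have := hu.2.1
  grind

/-- We write `ij` for the pair `(b uᵢ, c uⱼ)`. -/
lemma cell_of_pairedFour [Finite V] (h6 : SixMeet a b c) (hcov : NoThreeCover a b c)
    (hu : PairedFour a b c u₁ u₂ u₃ u₄) (h₁ : a g ≠ a u₁) (h₃ : a g ≠ a u₃) :
    (b g = b u₁ ∨ b g = b u₂) ∧ (c g = c u₃ ∨ c g = c u₄) ∨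
      (b g = b u₃ ∨ b g = b u₄) ∧ (c g = c u₁ ∨ c g = c u₂) := by
  have hl := hu.swap_left
  have hp := hu.swap_pairs
  have hpl := hp.swap_left
  have k₁ : a g ≠ a u₂ := hu.2.1 ▸ h₁
  have k₃ : a g ≠ a u₄ := hu.2.2.1 ▸ h₃
  have e₁ := not_cell_12 h6 hcov hu h₁ h₃
  have e₂ := not_cell_12 h6 hcov hl k₁ h₃
  have e₃ := not_cell_12 h6 hcov hp h₃ h₁
  have e₄ := not_cell_12 h6 hcov hpl k₃ h₁
  have f₁ := meet_of_pairedFour h6 hcov hu h₁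
  have f₂ := meet_of_pairedFour h6 hcov hl k₁
  have f₃ := meet_of_pairedFour h6 hcov hp h₃
  have f₄ := meet_of_pairedFour h6 hcov hpl k₃
  simp only [PairedFour, FourApart, Apart] at hu
  clear hl hp hpl h6 hcov
  grind

lemma not_cell_13_24 (h6 : SixMeet a b c) (hu : PairedFour a b c u₁ u₂ u₃ u₄)
    (h₁ : a g ≠ a u₁) (h₃ : a g ≠ a u₃) (h₁' : a g' ≠ a u₁) (h₃' : a g' ≠ a u₃)
    (hb : b g = b u₁) (hc : c g = c u₃) (hb' : b g' = b u₂) : c g' ≠ c u₄ := by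
  intro hc'
  obtain ⟨x, y, z, hm⟩ := h6 u₁ u₂ u₃ u₄ g g'
  simp only [PairedFour, FourApart, Apart] at *
  grind

lemma not_cell_13_31 (h6 : SixMeet a b c) (hu : PairedFour a b c u₁ u₂ u₃ u₄)
    (h₁ : a g ≠ a u₁) (h₃ : a g ≠ a u₃) (h₁' : a g' ≠ a u₁) (h₃' : a g' ≠ a u₃)
    (hb : b g = b u₁) (hc : c g = c u₃) (hb' : b g' = b u₃) : c g' ≠ c u₁ := by
  intro hc'
  obtain ⟨x, y, z, hm⟩ := h6 u₁ u₂ u₃ u₄ g g'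
  simp only [PairedFour, FourApart, Apart] at *
  grind

/-- Cell `13` leaves only the transversals `a u₁` with `43` and `a u₃` with `12`. Here `g'` rules
out the former and `h` the latter; `u₁` is dropped to stay within six edges. -/
lemma not_cell_13_32 (h6 : SixMeet a b c) (hcov : NoThreeCover a b c)
    (hu : PairedFour a b c u₁ u₂ u₃ u₄)
    (h₁ : a g ≠ a u₁) (h₃ : a g ≠ a u₃) (h₁' : a g' ≠ a u₁) (h₃' : a g' ≠ a u₃)
    (hb : b g = b u₁) (hc : c g = c u₃) (hb' : b g' = b u₃) : c g' ≠ c u₂ := by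
  intro hc'
  obtain ⟨h, hh⟩ := hcov.exists_avoid_abc (a u₃) (b u₁) (c u₂)
  obtain ⟨x, y, z, hm⟩ := h6 u₂ u₃ u₄ g g' h
  simp only [PairedFour, FourApart, Apart] at *
  grind

lemma not_cell_13_41 (h6 : SixMeet a b c) (hcov : NoThreeCover a b c)
    (hu : PairedFour a b c u₁ u₂ u₃ u₄)
    (h₁ : a g ≠ a u₁) (h₃ : a g ≠ a u₃) (h₁' : a g' ≠ a u₁) (h₃' : a g' ≠ a u₃)
    (hb : b g = b u₁) (hc : c g = c u₃) (hb' : b g' = b u₄) : c g' ≠ c u₁ := by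
  intro hc'
  obtain ⟨h, hh⟩ := hcov.exists_avoid_abc (a u₁) (b u₄) (c u₃)
  obtain ⟨x, y, z, hm⟩ := h6 u₁ u₂ u₄ g g' h
  simp only [PairedFour, FourApart, Apart] at *
  grind

/-- An edge apart from an edge in the cell `13` can only lie in the cell `42`. -/
lemma cell_42_of_cell_13 [Finite V] (h6 : SixMeet a b c) (hcov : NoThreeCover a b c)
    (hu : PairedFour a b c u₁ u₂ u₃ u₄)
    (h₁ : a g ≠ a u₁) (h₃ : a g ≠ a u₃) (h₁' : a g' ≠ a u₁) (h₃' : a g' ≠ a u₃)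
    (hb : b g = b u₁) (hc : c g = c u₃) (hb' : b g' ≠ b u₁) (hc' : c g' ≠ c u₃) :
    b g' = b u₄ ∧ c g' = c u₂ := by
  have e₁ := not_cell_13_24 h6 hu h₁ h₃ h₁' h₃' hb hc
  have e₂ := not_cell_13_31 h6 hu h₁ h₃ h₁' h₃' hb hc
  have e₃ := not_cell_13_32 h6 hcov hu h₁ h₃ h₁' h₃' hb hc
  have e₄ := not_cell_13_41 h6 hcov hu h₁ h₃ h₁' h₃' hb hc
  have := cell_of_pairedFour h6 hcov hu h₁' h₃'
  clear h6 hcov hu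
  grind

/-- If the cell `13` is occupied, then so is the cell `42`. -/
lemma exists_cell_42 [Finite V] (h6 : SixMeet a b c) (hcov : NoThreeCover a b c)
    (hu : PairedFour a b c u₁ u₂ u₃ u₄)
    (h₁ : a g ≠ a u₁) (h₃ : a g ≠ a u₃) (hb : b g = b u₁) (hc : c g = c u₃) :
    ∃ g', a g' ≠ a u₁ ∧ a g' ≠ a u₃ ∧ b g' = b u₄ ∧ c g' = c u₂ := by
  obtain ⟨r, hr₁, hr₃, hrb⟩ := hcov.exists_avoid_aab (a u₁) (a u₃) (b u₁)
  obtain ⟨s, hs₁, hs₃, hsc⟩ := hcov.exists_avoid_aac (a u₁) (a u₃) (c u₃)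
  by_cases hrc : c r = c u₃
  · by_cases hsb : b s = b u₁
    · have hr : b r = b u₂ := by
        have := cell_of_pairedFour h6 hcov hu hr₁ hr₃
        simp only [PairedFour, FourApart, Apart] at hu
        grind
      have hs : c s = c u₄ := by
        have := cell_of_pairedFour h6 hcov hu hs₁ hs₃
        simp only [PairedFour, FourApart, Apart] at hu
        grind
      have h₂ := hu.2.1
      exact absurd hs (not_cell_13_24 h6 hu.swap_left (h₂ ▸ hr₁) hr₃ (h₂ ▸ hs₁) hs₃ hr hrc hsb)
    · exact ⟨s, hs₁, hs₃, cell_42_of_cell_13 h6 hcov hu h₁ h₃ hs₁ hs₃ hb hc hsb hsc⟩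
  · exact ⟨r, hr₁, hr₃, cell_42_of_cell_13 h6 hcov hu h₁ h₃ hr₁ hr₃ hb hc hrb hrc⟩

/-- If the cell `13` is occupied, then no cell other than `13` and `42` is. -/
lemma cell_13_or_42 [Finite V] (h6 : SixMeet a b c) (hcov : NoThreeCover a b c)
    (hu : PairedFour a b c u₁ u₂ u₃ u₄)
    (h₁ : a g ≠ a u₁) (h₃ : a g ≠ a u₃) (hb : b g = b u₁) (hc : c g = c u₃)
    (h₁' : a g' ≠ a u₁) (h₃' : a g' ≠ a u₃) :
    b g' = b u₁ ∧ c g' = c u₃ ∨ b g' = b u₄ ∧ c g' = c u₂ := by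
  obtain ⟨s, hs₁, hs₃, hsb, hsc⟩ := exists_cell_42 h6 hcov hu h₁ h₃ hb hc
  have h₂ := hu.2.1
  have h₄ := hu.2.2.1
  have e₁ := cell_42_of_cell_13 h6 hcov hu h₁ h₃ h₁' h₃' hb hc
  have e₂ := cell_42_of_cell_13 h6 hcov hu.swap_pairs.swap_left (h₄ ▸ hs₃) hs₁ (h₄ ▸ h₃') h₁' hsb
  have e₃ := cell_of_pairedFour h6 hcov hu h₁' h₃'
  have e₄ := not_cell_13_41 h6 hcov hu.swap_left (g := g') (g' := s) (h₂ ▸ h₁') h₃' (h₂ ▸ hs₁) hs₃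
  have e₅ := not_cell_13_32 h6 hcov hu.swap_right (g := g') (g' := s) h₁' (h₄ ▸ h₃') hs₁ (h₄ ▸ hs₃)
  simp only [PairedFour, FourApart, Apart] at hu
  clear h6 hcov
  grind

/-- The edges `h` and `k` miss the two transversals that cells `13` and `42` still allow. Two
transversals fix the last two coordinates of `h` and `k`, and a third is then impossible. -/
lemma false_of_cell_13_42 [Finite V] (h6 : SixMeet a b c) (hcov : NoThreeCover a b c)
    (hu : PairedFour a b c u₁ u₂ u₃ u₄)
    (h₁ : a g ≠ a u₁) (h₃ : a g ≠ a u₃) (hb : b g = b u₁) (hc : c g = c u₃)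
    (h₁' : a g' ≠ a u₁) (h₃' : a g' ≠ a u₃) (hb' : b g' = b u₄) (hc' : c g' = c u₂)
    (hne : a g ≠ a g') : False := by
  obtain ⟨h, hha, hhb, hhc⟩ := hcov.exists_avoid_abc (a u₃) (b u₁) (c u₂)
  obtain ⟨k, hka, hkb, hkc⟩ := hcov.exists_avoid_abc (a u₁) (b u₄) (c u₃)
  have hh : a h = a u₁ := by
    by_contra hh
    have := cell_13_or_42 h6 hcov hu h₁ h₃ hb hc hh hha
    grind
  have hk : a k = a u₃ := by
    by_contra hk
    have := cell_13_or_42 h6 hcov hu h₁ h₃ hb hc hka hk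
    grind
  obtain ⟨x, y, z, hm⟩ := h6 u₁ u₃ g g' h k
  obtain ⟨x', y', z', hm'⟩ := h6 u₂ u₄ g g' h k
  obtain ⟨x'', y'', z'', hm''⟩ := h6 u₂ u₃ g g' h k
  simp only [PairedFour, FourApart, Apart] at hu
  have k₁ : c h = c u₃ ∧ b k = b u₁ := by
    clear hm' hm'' h6 hcov
    grind
  have k₂ : b h = b u₄ ∧ c k = c u₂ := by
    clear hm hm'' h6 hcov
    grind
  clear hm hm' h6 hcov
  grind

/-- If the occupants of `13` and `42` share their first coordinate, an edge `r` avoiding it replaces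
one of them. -/
lemma false_of_cell_13 [Finite V] (h6 : SixMeet a b c) (hcov : NoThreeCover a b c)
    (hu : PairedFour a b c u₁ u₂ u₃ u₄)
    (h₁ : a g ≠ a u₁) (h₃ : a g ≠ a u₃) (hb : b g = b u₁) (hc : c g = c u₃) : False := by
  obtain ⟨s, hs₁, hs₃, hsb, hsc⟩ := exists_cell_42 h6 hcov hu h₁ h₃ hb hc
  by_cases hgs : a g = a s
  · obtain ⟨r, hr₁, hr₃, hrg⟩ := hcov.exists_avoid_aaa (a u₁) (a u₃) (a g)
    rcases cell_13_or_42 h6 hcov hu h₁ h₃ hb hc hr₁ hr₃ with ⟨hrb, hrc⟩ | ⟨hrb, hrc⟩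
    · exact false_of_cell_13_42 h6 hcov hu hr₁ hr₃ hrb hrc hs₁ hs₃ hsb hsc (hgs ▸ hrg)
    · exact false_of_cell_13_42 h6 hcov hu h₁ h₃ hb hc hr₁ hr₃ hrb hrc hrg.symm
  · exact false_of_cell_13_42 h6 hcov hu h₁ h₃ hb hc hs₁ hs₃ hsb hsc hgs

end PairedFour

/-- A finite 3-partite 3-uniform hypergraph in which any six edges are met by a common transversal
has a vertex cover of size at most three. -/
theorem not_noThreeCover_of_sixMeet [Finite V] (h6 : SixMeet a b c) : ¬ NoThreeCover a b c := by
  intro hcov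
  obtain ⟨u₁, u₂, u₃, u₄, hu⟩ := exists_pairedFour h6 hcov
  obtain ⟨g, h₁, h₃, -⟩ := hcov.exists_avoid_aaa (a u₁) (a u₃) (a u₁)
  have h₂ : a g ≠ a u₂ := hu.2.1 ▸ h₁
  have h₄ : a g ≠ a u₄ := hu.2.2.1 ▸ h₃
  have hl := hu.swap_left
  have hr := hu.swap_right
  have hp := hu.swap_pairs
  -- The symmetries of the two pairs carry each of the eight cells to `13`.
  rcases cell_of_pairedFour h6 hcov hu h₁ h₃ with ⟨hb | hb, hc | hc⟩ | ⟨hb | hb, hc | hc⟩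
  · exact false_of_cell_13 h6 hcov hu h₁ h₃ hb hc
  · exact false_of_cell_13 h6 hcov hr h₁ h₄ hb hc
  · exact false_of_cell_13 h6 hcov hl h₂ h₃ hb hc
  · exact false_of_cell_13 h6 hcov hl.swap_right h₂ h₄ hb hc
  · exact false_of_cell_13 h6 hcov hp h₃ h₁ hb hc
  · exact false_of_cell_13 h6 hcov hp.swap_right h₃ h₂ hb hc
  · exact false_of_cell_13 h6 hcov hp.swap_left h₄ h₁ hb hc
  · exact false_of_cell_13 h6 hcov hp.swap_left.swap_right h₄ h₂ hb hc

end Hypergraph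

/-! ### From hypergraph covers to monochromatic trees -/

namespace SimpleGraph

variable {V : Type*} {G : SimpleGraph V}

lemma exists_isMonochromaticTree_supp_subset {K : Type*} (φ : G.EdgeLabeling K) (k : K)
    (C : (φ.labelGraph k).ConnectedComponent) :
    ∃ T : G.Subgraph, IsMonochromaticTree φ T ∧ C.supp ⊆ T.verts := by
  obtain ⟨T₀, hle, hT₀⟩ := C.connected_toSimpleGraph.exists_isTree_le
  have hadj : ∀ u v (hu : u ∈ C) (hv : v ∈ C), T₀.Adj ⟨u, hu⟩ ⟨v, hv⟩ →
      ∃ h : G.Adj u v, φ ⟨s(u, v), h⟩ = k := fun u v hu hv h =>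
    (EdgeLabeling.labelGraph_adj u v).1 (hle h)
  let T : G.Subgraph :=
    { verts := C.supp
      Adj := fun u v => ∃ (hu : u ∈ C) (hv : v ∈ C), T₀.Adj ⟨u, hu⟩ ⟨v, hv⟩
      adj_sub := fun ⟨hu, hv, h⟩ => (hadj _ _ hu hv h).1
      edge_vert := fun ⟨hu, _, _⟩ => hu
      symm := ⟨fun _ _ ⟨hu, hv, h⟩ => ⟨hv, hu, h.symm⟩⟩ }
  have hT : T.coe = T₀ := by
    ext u v
    exact ⟨fun ⟨_, _, h⟩ => h, fun h => ⟨u.2, v.2, h⟩⟩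
  refine ⟨T, ⟨hT ▸ hT₀, k, fun e he => ?_⟩, subset_rfl⟩
  induction e using Sym2.ind with
  | _ u v =>
    obtain ⟨hu, hv, h⟩ := he
    exact (hadj u v hu hv h).2

/-- If any six vertices have a common neighbour, then in every edge-colouring with three colours
there are three monochromatic trees covering all vertices. -/
theorem treeCoverable_of_common_neighbors [Finite V] [Nonempty V]
    (h : ∀ v : Fin 6 → V, ∃ w, ∀ i, G.Adj (v i) w) : G.TreeCoverable 3 3 := by
  classical
  intro φ
  let κ : ∀ k : Fin 3, V → (φ.labelGraph k).ConnectedComponent :=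
    fun k => (φ.labelGraph k).connectedComponentMk
  have h6 : SixMeet (κ 0) (κ 1) (κ 2) := by
    intro v₁ v₂ v₃ v₄ v₅ v₆
    obtain ⟨w, hw⟩ := h ![v₁, v₂, v₃, v₄, v₅, v₆]
    have key : ∀ v, G.Adj v w → κ 0 v = κ 0 w ∨ κ 1 v = κ 1 w ∨ κ 2 v = κ 2 w := by
      intro v hv
      have hk : ∀ k, φ ⟨s(v, w), hv⟩ = k → κ k v = κ k w := fun k hk =>
        ConnectedComponent.sound ((EdgeLabeling.labelGraph_adj v w).2 ⟨hv, hk⟩).reachable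
      generalize φ ⟨s(v, w), hv⟩ = k at hk
      fin_cases k
      · exact .inl (hk 0 rfl)
      · exact .inr (.inl (hk 1 rfl))
      · exact .inr (.inr (hk 2 rfl))
    exact ⟨κ 0 w, κ 1 w, κ 2 w, key _ (hw 0), key _ (hw 1), key _ (hw 2), key _ (hw 3),
      key _ (hw 4), key _ (hw 5)⟩
  have hcov := not_noThreeCover_of_sixMeet h6
  simp only [NoThreeCover, not_forall, not_exists] at hcov
  obtain ⟨P, Q, R, hcard, hcov⟩ := hcov
  choose t htree hsupp using fun k => exists_isMonochromaticTree_supp_subset φ k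
  let S : Finset G.Subgraph := P.image (t 0) ∪ Q.image (t 1) ∪ R.image (t 2)
  have hScard : S.card ≤ 3 := calc
    S.card ≤ (P.image (t 0)).card + (Q.image (t 1)).card + (R.image (t 2)).card :=
      (Finset.card_union_le _ _).trans (Nat.add_le_add_right (Finset.card_union_le _ _) _)
    _ ≤ P.card + Q.card + R.card :=
      Nat.add_le_add (Nat.add_le_add Finset.card_image_le Finset.card_image_le)
        Finset.card_image_le
    _ ≤ 3 := hcard
  have hStree : ∀ T ∈ S, IsMonochromaticTree φ T := by
    intro T hT
    simp only [S, Finset.mem_union, Finset.mem_image] at hT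
    rcases hT with (⟨C, -, rfl⟩ | ⟨C, -, rfl⟩) | ⟨C, -, rfl⟩ <;> exact htree _ _
  have hScov : ∀ v, ∃ T ∈ S, v ∈ T.verts := by
    intro v
    have hmem : ∀ k, v ∈ (t k (κ k v)).verts := fun k => hsupp k _ rfl
    have hS : ∀ k, t k (κ k v) ∈ S → ∃ T ∈ S, v ∈ T.verts := fun k hk => ⟨_, hk, hmem k⟩
    simp only [S, Finset.mem_union] at hS ⊢
    by_cases h₀ : κ 0 v ∈ P
    · exact hS 0 (.inl (.inl (Finset.mem_image_of_mem _ h₀)))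
    by_cases h₁ : κ 1 v ∈ Q
    · exact hS 1 (.inl (.inr (Finset.mem_image_of_mem _ h₁)))
    by_cases h₂ : κ 2 v ∈ R
    · exact hS 2 (.inr (Finset.mem_image_of_mem _ h₂))
    exact (hcov v ⟨h₀, h₁, h₂⟩).elim
  have : Nonempty S := by
    obtain ⟨T, hT, -⟩ := hScov (Classical.arbitrary V)
    exact ⟨⟨T, hT⟩⟩
  obtain ⟨e⟩ : Nonempty (S ↪ Fin 3) :=
    Function.Embedding.nonempty_of_card_le (by simpa using hScard)
  -- If `S` has fewer than three trees, the spare indices repeat a tree of `S`.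
  refine ⟨fun i => (Function.invFun e i : S), fun i => hStree _ (Function.invFun e i).2, ?_⟩
  refine Set.eq_univ_of_forall fun v => ?_
  obtain ⟨T, hT, hv⟩ := hScov v
  refine Set.mem_iUnion.2 ⟨e ⟨T, hT⟩, ?_⟩
  simpa only [Function.leftInverse_invFun e.injective _] using hv

lemma treeCoverNumber_le_three_of_common_neighbors [Finite V] [Nonempty V]
    (h : ∀ v : Fin 6 → V, ∃ w, ∀ i, G.Adj (v i) w) : G.treeCoverNumber 3 ≤ 3 :=
  iInf₂_le 3 (treeCoverable_of_common_neighbors h)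

end SimpleGraph

/-! ### Common neighbours in the random graph -/

open MeasureTheory ProbabilityTheory unitInterval

/-- Events about pairwise disjoint finite sets of coordinates are independent under a product
measure: the probability that every block `E w`, `w ∈ D`, contains a coordinate outside `t`. -/
lemma infinitePi_forall_exists_notMem {ι W : Type*} {X : ι → Type*} [∀ i, MeasurableSpace (X i)]
    (μ : ∀ i, Measure (X i)) [∀ i, IsProbabilityMeasure (μ i)] {t : ∀ i, Set (X i)}
    (ht : ∀ i, MeasurableSet (t i)) (E : W → Finset ι) (D : Finset W)
    (hE : (D : Set W).PairwiseDisjoint E) :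
    Measure.infinitePi μ {ω | ∀ w ∈ D, ∃ i ∈ E w, ω i ∉ t i} =
      ∏ w ∈ D, (1 - ∏ i ∈ E w, μ i (t i)) := by
  classical
  induction D using Finset.induction_on with
  | empty => simp
  | insert w D hw ih =>
    have hD := ih (hE.subset (by simp))
    have hdisj : Disjoint (E w) (D.biUnion E) := by
      rw [Finset.disjoint_biUnion_right]
      intro w' hw'
      exact hE (by simp) (by simp [hw']) (by rintro rfl; exact hw hw')
    have hind := iIndepFun.indepFun_finset (μ := Measure.infinitePi μ) (E w) (D.biUnion E) hdisj
      (iIndepFun_infinitePi (P := μ) (X := fun i ω => ω) fun i => measurable_id)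
      (fun i => measurable_pi_apply i)
    have hm : ∀ S : Finset ι, MeasurableSet {ω : ∀ i : S, X i | ∃ i : S, ω i ∉ t i} := by
      intro S
      rw [Set.ofPred_exists]
      exact MeasurableSet.iUnion fun i => (measurable_pi_apply i (ht i)).compl
    have hm' : MeasurableSet {ω : ∀ i : D.biUnion E, X i |
        ∀ v : D, ∃ i : E v, ω ⟨i, Finset.mem_biUnion.2 ⟨v, v.2, i.2⟩⟩ ∉ t i} := by
      rw [Set.ofPred_forall]
      refine MeasurableSet.iInter fun v => ?_
      rw [Set.ofPred_exists]
      exact MeasurableSet.iUnion fun i =>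
        (measurable_pi_apply (⟨i, Finset.mem_biUnion.2 ⟨v, v.2, i.2⟩⟩ : D.biUnion E) (ht i)).compl
    have h := hind.measure_inter_preimage_eq_mul _ _ (hm (E w)) hm'
    have hw₁ : (fun (ω : ∀ i, X i) (i : E w) => ω i) ⁻¹'
        {ω : ∀ i : E w, X i | ∃ i : E w, ω i ∉ t i} = (Set.pi (E w) t)ᶜ := by
      ext ω
      simp only [Set.mem_preimage, Set.mem_ofPred_eq, Set.mem_compl_iff, Set.mem_pi, not_forall]
      exact ⟨fun ⟨i, hi⟩ => ⟨i, i.2, hi⟩, fun ⟨i, hi, h⟩ => ⟨⟨i, hi⟩, h⟩⟩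
    have hD₁ : (fun (ω : ∀ i, X i) (i : D.biUnion E) => ω i) ⁻¹' {ω : ∀ i : D.biUnion E, X i |
        ∀ v : D, ∃ i : E v, ω ⟨i, Finset.mem_biUnion.2 ⟨v, v.2, i.2⟩⟩ ∉ t i} =
        {ω | ∀ w ∈ D, ∃ i ∈ E w, ω i ∉ t i} := by
      ext ω
      exact ⟨fun H w hw => let ⟨i, hi⟩ := H ⟨w, hw⟩; ⟨i, i.2, hi⟩,
        fun H w => let ⟨i, hi, h⟩ := H w w.2; ⟨⟨i, hi⟩, h⟩⟩
    have hins : {ω : ∀ i, X i | ∀ w' ∈ insert w D, ∃ i ∈ E w', ω i ∉ t i} =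
        (Set.pi (E w) t)ᶜ ∩ {ω | ∀ w ∈ D, ∃ i ∈ E w, ω i ∉ t i} := by
      ext ω
      simp [Set.mem_pi, Set.mem_compl_iff]
    rw [hw₁, hD₁] at h
    rw [hins, h, hD, Finset.prod_insert hw, prob_compl_eq_one_sub
      (MeasurableSet.pi (E w).countable_toSet fun i _ => ht i),
      Measure.infinitePi_pi _ fun i _ => ht i]

namespace SimpleGraph

variable {V : Type*}

/-- The probability that a fixed tuple of `k` vertices of `G(n,p)` has no common neighbour is at
most `(1 - p ^ k) ^ (n - k)`. -/
lemma binomialRandom_forall_exists_not_adj_le [Fintype V] (p : I) {k : ℕ} (v : Fin k → V) :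
    binomialRandom V p {G | ∀ w, ∃ i, ¬ G.Adj (v i) w} ≤
      (1 - (toNNReal p : ENNReal) ^ k) ^ (Fintype.card V - k) := by
  classical
  -- The tuple may repeat vertices, hence `s.card ≤ k`. Only `w` outside `s` are used: their blocks
  -- of pairs `E w` are disjoint and loop-free.
  let s : Finset V := Finset.univ.image v
  have hs : s.card ≤ k := Finset.card_image_le.trans (by simp)
  let E : V → Finset (Sym2 V) := fun w => s.image fun u => s(u, w)
  have hinj : ∀ w, Function.Injective fun u : V => s(u, w) := fun w u u' h => by
    simp only [Sym2.eq_iff] at h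
    grind
  have hE : ((sᶜ : Finset V) : Set V).PairwiseDisjoint E := by
    intro w hw w' hw' hne
    simp only [Function.onFun, E, Finset.disjoint_left, Finset.mem_image]
    rintro _ ⟨u, hu, rfl⟩ ⟨u', hu', h⟩
    simp only [Finset.coe_compl, Set.mem_compl_iff, Finset.mem_coe] at hw hw'
    rcases Sym2.eq_iff.1 h with ⟨-, h⟩ | ⟨h, -⟩
    · exact hne h.symm
    · exact hw (h ▸ hu')
  let μ : Sym2 V → Measure Prop := fun e =>
    toNNReal p • Measure.dirac (¬ e.IsDiag) + toNNReal (σ p) • Measure.dirac False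
  have hμ : ∀ e : Sym2 V, ¬ e.IsDiag → μ e {True} = toNNReal p := by
    intro e he
    simp [μ, he]
  rw [binomialRandom_apply]
  change Measure.infinitePi μ _ ≤ _
  have hmain := infinitePi_forall_exists_notMem μ (t := fun _ => {True})
    (fun _ => MeasurableSet.of_discrete) E sᶜ hE
  calc _ ≤ Measure.infinitePi μ {ω | ∀ w ∈ sᶜ, ∃ i ∈ E w, ω i ∉ ({True} : Set Prop)} := by
        refine measure_mono ?_
        rintro _ ⟨G, hG, rfl⟩ w -
        obtain ⟨i, hi⟩ := hG w
        exact ⟨s(v i, w), Finset.mem_image_of_mem _ (Finset.mem_image_of_mem _ (by simp)),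
          by simpa using hi⟩
    _ = (1 - (toNNReal p : ENNReal) ^ s.card) ^ (Fintype.card V - s.card) := by
        rw [hmain, Finset.prod_congr rfl, Finset.prod_const, Finset.card_compl]
        intro w hw
        rw [Finset.prod_congr rfl fun e he => hμ e ?_, Finset.prod_const,
          Finset.card_image_of_injective _ (hinj w)]
        obtain ⟨u, hu, rfl⟩ := Finset.mem_image.1 he
        exact fun h => (Finset.mem_compl.1 hw) (Sym2.mk_isDiag_iff.1 h ▸ hu)
    _ ≤ (1 - (toNNReal p : ENNReal) ^ k) ^ (Fintype.card V - k) := by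
        have hp : (toNNReal p : ENNReal) ≤ 1 := by exact_mod_cast p.2.2
        refine (pow_le_pow_left' (tsub_le_tsub_left (pow_le_pow_right_of_le_one' hp hs) _) _).trans ?_
        exact pow_le_pow_right_of_le_one' tsub_le_self (Nat.sub_le_sub_left hs _)

lemma binomialRandom_exists_forall_exists_not_adj_le [Fintype V] (p : I) (k : ℕ) :
    binomialRandom V p {G | ∃ v : Fin k → V, ∀ w, ∃ i, ¬ G.Adj (v i) w} ≤
      (Fintype.card V : ENNReal) ^ k * (1 - (toNNReal p : ENNReal) ^ k) ^ (Fintype.card V - k) := by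
  classical
  rw [Set.ofPred_exists]
  refine (measure_iUnion_fintype_le _ _).trans ?_
  refine (Finset.sum_le_sum fun v _ => binomialRandom_forall_exists_not_adj_le p v).trans ?_
  simp

end SimpleGraph

/-! ### Asymptotics and conclusion -/

lemma eventually_pow_mul_one_sub_pow_le (p : ℕ → I)
    (hp : (fun n : ℕ => (Real.log (n : ℝ) / (n : ℝ)) ^ (1 / 6 : ℝ)) =o[atTop]
      (fun n : ℕ => (p n : ℝ))) :
    ∀ᶠ n : ℕ in atTop, (n : ℝ) ^ 6 * (1 - (p n : ℝ) ^ 6) ^ (n - 6) ≤ (n : ℝ)⁻¹ := by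
  -- The constant `1 / 2` gives `p ^ 6 ≥ 64 log n / n`, and `n ≥ 12` gives `n - 6 ≥ n / 2`; this is
  -- ample for the exponent `7 log n`, which beats `n ^ 6`.
  filter_upwards [hp.bound (c := 1 / 2) (by norm_num), eventually_ge_atTop 12] with n hn h12
  have h12' : (12 : ℝ) ≤ n := by exact_mod_cast h12
  have hn0 : (0 : ℝ) < n := by linarith
  have hlog : 0 ≤ Real.log n := Real.log_nonneg (by linarith)
  have hx : 0 ≤ Real.log n / n := by positivity
  have hp0 : (0 : ℝ) ≤ p n := (p n).2.1
  have hp1 : (p n : ℝ) ^ 6 ≤ 1 := pow_le_one₀ hp0 (p n).2.2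
  rw [Real.norm_of_nonneg (Real.rpow_nonneg hx _), Real.norm_of_nonneg hp0] at hn
  have h6 : Real.log n / n ≤ (p n : ℝ) ^ 6 / 64 := by
    have := pow_le_pow_left₀ (Real.rpow_nonneg hx _) hn 6
    rw [← Real.rpow_natCast, ← Real.rpow_mul hx] at this
    norm_num at this
    linarith
  have hmul : 7 * Real.log n ≤ (p n : ℝ) ^ 6 * ((n - 6 : ℕ) : ℝ) := by
    rw [Nat.cast_sub (by omega), Nat.cast_ofNat]
    rw [div_le_iff₀ hn0] at h6
    have : (p n : ℝ) ^ 6 * n / 2 ≤ (p n : ℝ) ^ 6 * (n - 6) := by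
      nlinarith [pow_nonneg hp0 6]
    linarith
  calc (n : ℝ) ^ 6 * (1 - (p n : ℝ) ^ 6) ^ (n - 6)
      ≤ (n : ℝ) ^ 6 * Real.exp (-(p n : ℝ) ^ 6) ^ (n - 6) := by
        gcongr
        linarith [Real.add_one_le_exp (-(p n : ℝ) ^ 6)]
    _ = (n : ℝ) ^ 6 * Real.exp (-((p n : ℝ) ^ 6 * ((n - 6 : ℕ) : ℝ))) := by
        rw [← Real.exp_nat_mul]
        ring_nf
    _ ≤ (n : ℝ) ^ 6 * Real.exp (-(7 * Real.log n)) := by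
        gcongr
    _ = (n : ℝ)⁻¹ := by
        rw [Real.exp_neg, mul_comm (7 : ℝ), Real.exp_mul, Real.exp_log hn0]
        norm_cast
        field_simp
        norm_cast

theorem theorem1p1 (p : ℕ → unitInterval)
    (hp : (fun n : ℕ => (Real.log (n : ℝ) / (n : ℝ)) ^ (1 / 6 : ℝ)) =o[atTop]
      (fun n : ℕ => (p n : ℝ))) :
    Tendsto
      (fun n : ℕ => SimpleGraph.binomialRandom (Fin n) (p n)
        {G : SimpleGraph (Fin n) | G.treeCoverNumber 3 ≤ 3})
      atTop (𝓝 1) := by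
  have hlim : Tendsto (fun n : ℕ => 1 - ENNReal.ofReal (n : ℝ)⁻¹) atTop (𝓝 1) := by
    have h := ENNReal.tendsto_ofReal (tendsto_inv_atTop_nhds_zero_nat (𝕜 := ℝ))
    simpa using ENNReal.Tendsto.sub (tendsto_const_nhds (x := (1 : ENNReal))) h (by simp)
  refine tendsto_of_tendsto_of_tendsto_of_le_of_le' hlim tendsto_const_nhds ?_
    (Eventually.of_forall fun n => prob_le_one)
  filter_upwards [eventually_pow_mul_one_sub_pow_le p hp, eventually_ge_atTop 1] with n hn h1
  have : Nonempty (Fin n) := ⟨⟨0, h1⟩⟩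
  let A : Set (SimpleGraph (Fin n)) := {G | G.treeCoverNumber 3 ≤ 3}
  let B : Set (SimpleGraph (Fin n)) := {G | ∃ v : Fin 6 → Fin n, ∀ w, ∃ i, ¬ G.Adj (v i) w}
  have hB : SimpleGraph.binomialRandom (Fin n) (p n) B ≤ ENNReal.ofReal (n : ℝ)⁻¹ := by
    refine (SimpleGraph.binomialRandom_exists_forall_exists_not_adj_le (p n) 6).trans ?_
    refine le_trans (le_of_eq ?_) (ENNReal.ofReal_le_ofReal hn)
    have hp0 : (0 : ℝ) ≤ p n := (p n).2.1
    have hp1 : (p n : ℝ) ^ 6 ≤ 1 := pow_le_one₀ hp0 (p n).2.2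
    have hpn : (toNNReal (p n) : ENNReal) = ENNReal.ofReal (p n) :=
      (ENNReal.ofReal_eq_coe_nnreal hp0).symm
    rw [ENNReal.ofReal_mul (by positivity), ENNReal.ofReal_pow (by positivity),
      ENNReal.ofReal_pow (by linarith), ENNReal.ofReal_sub _ (by positivity),
      ENNReal.ofReal_pow hp0, ENNReal.ofReal_natCast, ENNReal.ofReal_one, hpn, Fintype.card_fin]
  have hAB : Set.univ ⊆ A ∪ B := by
    intro G _
    by_cases hG : G ∈ B
    · exact .inr hG
    · refine .inl (SimpleGraph.treeCoverNumber_le_three_of_common_neighbors ?_)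
      simpa [B] using hG
  rw [tsub_le_iff_right]
  calc (1 : ENNReal) = SimpleGraph.binomialRandom (Fin n) (p n) Set.univ := measure_univ.symm
    _ ≤ _ := (measure_mono hAB).trans (measure_union_le _ _)
    _ ≤ _ := by gcongr
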